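/- **Setting.** $\lambda_c$-terms are generated, up to $\alpha$-equivalence, by $t,u ::= x \mid tu \mid \lambda x.t \mid \mathsf{cc} \mid k_\pi \mid \eta_n \mid \zeta_n$ ($n\in\mathbb N$; $\eta_n$ are the nonrestricted and $\zeta_n$ the restricted instructions), and stacks by $\pi ::= \omega_n \mid t\cdot\pi$ with $t$ closed; $\Lambda$ is the set of closed terms, $\Pi$ the set of stacks, and a process is a pair $t\star\pi$ with $t \in\Lambda$, $\pi\in\Pi$. Evaluation $\succ$ is the smallest preorder on processes such that $tu\star\pi\succ t\star u\cdot\pi$, $\ \lambda x.t\star u\cdot\pi\succ t[x:=u]\star\pi$, $\ \mathsf{cc}\star t\cdot\pi\succ t\star k_\pi\cdot\pi$, $\ k_{\pi'}\star t\cdot\pi\succ t\star\pi'$. A *pole* is a set $\bot\!\!\!\bot$ of processes such that $p\succ q\in\bot\!\!\!\bot$ implies $p\in\bot\!\!\!\bot$. A term is *proof-like* if it contains no $k_\pi$ and no $\zeta_n$. Formulas are $A,B ::= X(\vec a)\mid\top\mid\bot\mid A\to B\mid\forall x\,A\mid\forall X\,A\mid (a=b)\mapsto A\mid A\cap B\mid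 A\cup B\mid F(\vec a)$, where first-order terms $a,b$ are built from variables and all functions $\mathbb N^n\to\mathbb N$, $X$ ranges over $n$-ary second-order variables and $F$ over functions $\mathbb N^n\to\mathcal P(\Pi)$. The falsity value $\|A\|\subseteq\Pi$ of a closed formula with respect to a pole is given by $\|\top\|=\emptyset$, $\|\bot\|=\Pi$, $\|A\to B\|=\{t\cdot\pi : t\Vdash A,\ \pi\in\|B\|\}$, $\|\forall x A\|=\bigcup_{n\in\mathbb N}\|A[x:=n]\|$, $\|\forall X A\|=\bigcup_{F:\mathbb N^n\to\mathcal P(\Pi)}\|A[X:=F]\|$, $\|(a=b)\mapsto A\|=\|A\|$ if $a$ and $b$ have the same value and $\emptyset$ otherwise, $\|A\cap B\|=\|A\|\cup\|B\|$, $\|A\cup B\|=\|A\|\cap\|B\|$, $\|F(\vec a)\|=F(\vec a)$; here $t\Vdash A$ ($t$ *realizes* $A$) means that $t\star\pi\in\bot\!\!\!\bot$ for all $\pi\in\|A\|$. A closed formula is *universally realized* if one proof-like closed term realizes it with respect to every pole. For a set $\mathcal S$ of poles, the *theory generated by* $\mathcal S$ is the set of closed formulas $A$ such that one proof-like closed term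 realizes $A$ with respect to every pole in $\mathcal S$. Write $a=b$ for $\forall Z\,(Z(a)\to Z(b))$, $a\ne b$ for $(a=b)\mapsto\bot$, $A\wedge B$ for $\forall Z\,((A\to B\to Z)\to Z)$, $A\vee B$ for $\forall Z\,((A\to Z)\to(B\to Z)\to Z)$. Let $\gimel2(a)$ be the formula $\min(a+1,2)=a+1$, and let $\forall x^{\gimel 2}A$ be $\forall x\,\big((\min(x+1,2)=x+1)\mapsto A\big)$. On $\mathbb N$ let $m\vee n$ (resp. $m\wedge n$) be $1$ if $m>0$ or (resp. and) $n>0$, and $0$ otherwise, and let $\neg m$ be $1$ if $m=0$ and $0$ otherwise. The language of Boolean algebras has terms $a,b::=x\mid0\mid1\mid a\vee b\mid a\wedge b\mid\neg a$ and formulas $A,B::=\top\mid\bot\mid a\neq b\mid a=b\mid A\to B\mid A\vee B\mid A\wedge B\mid\forall x\,A$; for such a formula $A$, let $\gimel2\models A$ be the formula above obtained by turning every $\forall x$ into $\forall x^{\gimel2}$. **Proposition.** 1. Let $A$ be a closed formula of the language of Boolean algebras. If $A$ is true in every Boolean algebra with at least two elements, then $\gimel2\models A$ is universally realized. 2. Consequently,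 for every set $\mathcal S$ of poles, $\gimel2$ is a Boolean algebra with at least two elements according to the theory generated by $\mathcal S$: this theory contains $\gimel2(0)$, $\gimel2(1)$, $\forall x^{\gimel2}\forall y^{\gimel2}\,\gimel2(x\vee y)$, $\forall x^{\gimel2}\forall y^{\gimel2}\,\gimel2(x\wedge y)$, $\forall x^{\gimel2}\,\gimel2(\neg x)$, and $\gimel2\models E$ for each of the axioms $E$ of Boolean algebras with at least two elements (commutativity, associativity, absorption and distributivity of $\vee$ and $\wedge$, $x\vee\neg x=1$, $x\wedge\neg x=0$, and $0\neq1$). -/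

import Mathlib

namespace Realizability

/-! ### The lambda_c-calculus -/

mutual

/-- `Tm n`: lambda_c-terms whose free variables are among `n` given ones, up to alpha-equivalence
(well-scoped de Bruijn representation). `Tm 0` is the set of (closed) terms. -/
inductive Tm : ℕ → Type
  | var {n : ℕ} (i : Fin n) : Tm n
  | app {n : ℕ} (t u : Tm n) : Tm n
  | lam {n : ℕ} (t : Tm (n + 1)) : Tm n
  | cc {n : ℕ} : Tm n
  /-- continuation constants -/
  | cont {n : ℕ} (π : Stk) : Tm n
  /-- nonrestricted instructions -/
  | freeInstr {n : ℕ} (i : ℕ) : Tm n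
  /-- restricted instructions -/
  | restrInstr {n : ℕ} (i : ℕ) : Tm n

/-- Stacks: finite lists of closed terms ending in one of countably many stack bottoms. -/
inductive Stk : Type
  | bottom (i : ℕ) : Stk
  | cons (t : Tm 0) (π : Stk) : Stk

end

/-- Renaming of variables. -/
def Tm.rename : {n m : ℕ} → (Fin n → Fin m) → Tm n → Tm m
  | _, _, f, .var i => .var (f i)
  | _, _, f, .app t u => .app (t.rename f) (u.rename f)
  | _, _, f, .lam t => .lam (t.rename (Fin.cases 0 fun i => (f i).succ))
  | _, _, _, .cc => .cc
  | _, _, _, .cont π => .cont π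
  | _, _, _, .freeInstr i => .freeInstr i
  | _, _, _, .restrInstr i => .restrInstr i

/-- Simultaneous capture-avoiding substitution. -/
def Tm.subst : {n m : ℕ} → (Fin n → Tm m) → Tm n → Tm m
  | _, _, s, .var i => s i
  | _, _, s, .app t u => .app (t.subst s) (u.subst s)
  | _, _, s, .lam t => .lam (t.subst (Fin.cases (.var 0) fun i => (s i).rename Fin.succ))
  | _, _, _, .cc => .cc
  | _, _, _, .cont π => .cont π
  | _, _, _, .freeInstr i => .freeInstr i
  | _, _, _, .restrInstr i => .restrInstr i

/-- Proof-like terms: no continuation constant and no restricted instruction occurs. -/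
def Tm.ProofLike : {n : ℕ} → Tm n → Prop
  | _, .var _ => True
  | _, .app t u => t.ProofLike ∧ u.ProofLike
  | _, .lam t => t.ProofLike
  | _, .cc => True
  | _, .cont _ => False
  | _, .freeInstr _ => True
  | _, .restrInstr _ => False

/-- A process: a closed term against a stack. -/
structure Proc : Type where
  head : Tm 0
  stack : Stk

/-- One-step evaluation. -/
inductive Step : Proc → Proc → Prop
  | push (t u : Tm 0) (π : Stk) : Step ⟨.app t u, π⟩ ⟨t, .cons u π⟩
  | grab (t : Tm 1) (u : Tm 0) (π : Stk) :
      Step ⟨.lam t, .cons u π⟩ ⟨t.subst fun _ => u, π⟩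
  | save (t : Tm 0) (π : Stk) : Step ⟨.cc, .cons t π⟩ ⟨t, .cons (.cont π) π⟩
  | restore (t : Tm 0) (π π' : Stk) : Step ⟨.cont π', .cons t π⟩ ⟨t, π'⟩

/-- Evaluation: the smallest preorder containing one-step evaluation. -/
def Evaluates : Proc → Proc → Prop := Relation.ReflTransGen Step

/-- A pole: a set of processes closed under anti-evaluation. -/
structure Pole : Type where
  carrier : Set Proc
  anti_eval : ∀ p q : Proc, Evaluates p q → q ∈ carrier → p ∈ carrier

/-- The dual of a set of stacks with respect to a pole. -/
def Pole.dual (P : Pole) (X : Set Stk) : Set (Tm 0) :=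
  {t | ∀ π ∈ X, (⟨t, π⟩ : Proc) ∈ P.carrier}

/-! ### The realizability language -/

/-- First-order terms with `n` free variables; every function on the natural numbers is a function
symbol. -/
inductive FOTerm (n : ℕ) : Type
  | var (i : Fin n) : FOTerm n
  | func {k : ℕ} (f : (Fin k → ℕ) → ℕ) (a : Fin k → FOTerm n) : FOTerm n

/-- The value of a first-order term, its free variables having been replaced by the integers `ρ`. -/
def FOTerm.value {n : ℕ} (ρ : Fin n → ℕ) : FOTerm n → ℕ
  | .var i => ρ i
  | .func f a => f fun j => (a j).value ρ

/-- `PVar Γ k`: the `k`-ary second-order variables of the context `Γ`, a list of arities. -/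
inductive PVar : List ℕ → ℕ → Type
  | here {k : ℕ} {Γ : List ℕ} : PVar (k :: Γ) k
  | there {k l : ℕ} {Γ : List ℕ} (X : PVar Γ k) : PVar (l :: Γ) k

/-- Formulas with `n` free first-order variables and free second-order variables in `Γ`, up to
alpha-equivalence. `Form 0 []` is the set of closed formulas. -/
inductive Form : ℕ → List ℕ → Type
  | pvar {n : ℕ} {Γ : List ℕ} {k : ℕ} (X : PVar Γ k) (a : Fin k → FOTerm n) : Form n Γ
  | top {n : ℕ} {Γ : List ℕ} : Form n Γ
  | bot {n : ℕ} {Γ : List ℕ} : Form n Γ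
  | imp {n : ℕ} {Γ : List ℕ} (A B : Form n Γ) : Form n Γ
  /-- first-order quantification, binding the variable `0` -/
  | all {n : ℕ} {Γ : List ℕ} (A : Form (n + 1) Γ) : Form n Γ
  /-- second-order quantification over a `k`-ary variable -/
  | allP {n : ℕ} {Γ : List ℕ} (k : ℕ) (A : Form n (k :: Γ)) : Form n Γ
  /-- equational implication `(a = b) ↦ A` -/
  | eqImp {n : ℕ} {Γ : List ℕ} (a b : FOTerm n) (A : Form n Γ) : Form n Γ
  | inter {n : ℕ} {Γ : List ℕ} (A B : Form n Γ) : Form n Γ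
  | union {n : ℕ} {Γ : List ℕ} (A B : Form n Γ) : Form n Γ
  /-- `F(a₁, …, aₖ)` for a parameter `F : ℕᵏ → 𝒫(stacks)` -/
  | const {n : ℕ} {Γ : List ℕ} {k : ℕ} (F : (Fin k → ℕ) → Set Stk) (a : Fin k → FOTerm n) :
      Form n Γ

/-- Second-order valuations: parameters for the second-order variables of a context. -/
abbrev PVal (Γ : List ℕ) : Type := (k : ℕ) → PVar Γ k → (Fin k → ℕ) → Set Stk

/-- Extension of a second-order valuation by a value for a new variable. -/
def PVal.cons {Γ : List ℕ} {l : ℕ} (F : (Fin l → ℕ) → Set Stk) (σ : PVal Γ) : PVal (l :: Γ)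
  | _, .here => F
  | k, .there X => σ k X

/-- The empty second-order valuation. -/
def PVal.nil : PVal [] := fun _ X => nomatch X

/-- `A.falsity P ρ σ` is the falsity value with respect to `P` of the closed formula obtained from
`A` by replacing its free variables by the integers `ρ` and the parameters `σ`. -/
def Form.falsity (P : Pole) : {n : ℕ} → {Γ : List ℕ} →
    Form n Γ → (Fin n → ℕ) → PVal Γ → Set Stk
  | _, _, .pvar X a, ρ, σ => σ _ X fun j => (a j).value ρ
  | _, _, .top, _, _ => ∅
  | _, _, .bot, _, _ => Set.univ
  | _, _, .imp A B, ρ, σ =>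
      {π | ∃ t ∈ P.dual (A.falsity P ρ σ), ∃ π' ∈ B.falsity P ρ σ, π = Stk.cons t π'}
  | n, _, .all A, ρ, σ => ⋃ m : ℕ, A.falsity P (Fin.cons m ρ : Fin (n + 1) → ℕ) σ
  | _, _, .allP k A, ρ, σ => ⋃ F : (Fin k → ℕ) → Set Stk, A.falsity P ρ (PVal.cons F σ)
  | _, _, .eqImp a b A, ρ, σ => {π | a.value ρ = b.value ρ ∧ π ∈ A.falsity P ρ σ}
  | _, _, .inter A B, ρ, σ => A.falsity P ρ σ ∪ B.falsity P ρ σ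
  | _, _, .union A B, ρ, σ => A.falsity P ρ σ ∩ B.falsity P ρ σ
  | _, _, .const F a, ρ, _ => F fun j => (a j).value ρ

/-- `t` realizes the closed formula `A` with respect to the pole `P`, i.e. `t` belongs to the truth
value of `A`. -/
def Realizes (P : Pole) (t : Tm 0) (A : Form 0 []) : Prop :=
  t ∈ P.dual (A.falsity P Fin.elim0 PVal.nil)

/-- `A` is universally realized: a single proof-like term realizes it with respect to every pole. -/
def UniversallyRealized (A : Form 0 []) : Prop :=
  ∃ t : Tm 0, t.ProofLike ∧ ∀ P : Pole, Realizes P t A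

/-- The theory generated by a realizability structure (a set of poles): the closed formulas that some
proof-like term realizes with respect to all poles of the structure. -/
def theoryOf (S : Set Pole) : Set (Form 0 []) :=
  {A | ∃ t : Tm 0, t.ProofLike ∧ ∀ P ∈ S, Realizes P t A}

/-! ### Second-order encodings -/

/-- Renaming under a second-order binder. -/
def PVar.liftRename {Γ Δ : List ℕ} {l : ℕ} (f : (k : ℕ) → PVar Γ k → PVar Δ k) :
    (k : ℕ) → PVar (l :: Γ) k → PVar (l :: Δ) k
  | _, .here => .here
  | k, .there X => .there (f k X)

/-- Renaming of the free second-order variables of a formula. -/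
def Form.rename : {n : ℕ} → {Γ Δ : List ℕ} →
    ((k : ℕ) → PVar Γ k → PVar Δ k) → Form n Γ → Form n Δ
  | _, _, _, f, .pvar X a => .pvar (f _ X) a
  | _, _, _, _, .top => .top
  | _, _, _, _, .bot => .bot
  | _, _, _, f, .imp A B => .imp (A.rename f) (B.rename f)
  | _, _, _, f, .all A => .all (A.rename f)
  | _, _, _, f, .allP k A => .allP k (A.rename (PVar.liftRename f))
  | _, _, _, f, .eqImp a b A => .eqImp a b (A.rename f)
  | _, _, _, f, .inter A B => .inter (A.rename f) (B.rename f)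
  | _, _, _, f, .union A B => .union (A.rename f) (B.rename f)
  | _, _, _, _, .const F a => .const F a

/-- Weakening: `A` seen in a context with one more second-order variable. -/
def Form.weaken {n : ℕ} {Γ : List ℕ} (l : ℕ) (A : Form n Γ) : Form n (l :: Γ) :=
  A.rename fun _ X => .there X

/-- `a = b` is `∀ Z, Z(a) → Z(b)`. -/
def Form.eq {n : ℕ} {Γ : List ℕ} (a b : FOTerm n) : Form n Γ :=
  .allP 1 (.imp (.pvar .here ![a]) (.pvar .here ![b]))

/-- `a ≠ b` is `(a = b) ↦ ⊥`. -/
def Form.ne {n : ℕ} {Γ : List ℕ} (a b : FOTerm n) : Form n Γ := .eqImp a b .bot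

/-- `A ∧ B` is `∀ Z, (A → B → Z) → Z`. -/
def Form.and {n : ℕ} {Γ : List ℕ} (A B : Form n Γ) : Form n Γ :=
  .allP 0 (.imp (.imp (A.weaken 0) (.imp (B.weaken 0) (.pvar .here ![]))) (.pvar .here ![]))

/-- `A ∨ B` is `∀ Z, (A → Z) → (B → Z) → Z`. -/
def Form.or {n : ℕ} {Γ : List ℕ} (A B : Form n Γ) : Form n Γ :=
  .allP 0 (.imp (.imp (A.weaken 0) (.pvar .here ![]))
    (.imp (.imp (B.weaken 0) (.pvar .here ![])) (.pvar .here ![])))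

/-- The constant `m`. -/
def FOTerm.nat {n : ℕ} (m : ℕ) : FOTerm n := .func (k := 0) (fun _ => m) ![]

/-- The term `f(a)`, for a unary function `f`. -/
def FOTerm.un {n : ℕ} (f : ℕ → ℕ) (a : FOTerm n) : FOTerm n := .func (k := 1) (fun v => f (v 0)) ![a]

/-- The term `f(a, b)`, for a binary function `f`. -/
def FOTerm.bin {n : ℕ} (f : ℕ → ℕ → ℕ) (a b : FOTerm n) : FOTerm n :=
  .func (k := 2) (fun v => f (v 0) (v 1)) ![a, b]

/-! ### The predicates gimel -/

/-- The term `a + 1`. -/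
def FOTerm.succ {n : ℕ} (a : FOTerm n) : FOTerm n := .bin (fun x y => x + y) a (.nat 1)

/-- The formula gimel `p`, applied to `a`: it is `a + 1 ≤ p`, where `c ≤ d` is `min(c, d) = c`. -/
def Form.gimel {n : ℕ} {Γ : List ℕ} (p : ℕ) (a : FOTerm n) : Form n Γ :=
  .eq (.bin min a.succ (.nat p)) a.succ

/-- The relativized quantifier: `∀ x, (x + 1 ≤ p) ↦ A`. -/
def Form.allGimel {n : ℕ} {Γ : List ℕ} (p : ℕ) (A : Form (n + 1) Γ) : Form n Γ :=
  .all (.eqImp (.bin min (FOTerm.var 0).succ (.nat p)) (FOTerm.var 0).succ A)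

/-- The operation `∨` on natural numbers. -/
def natSup (m n : ℕ) : ℕ := if m > 0 ∨ n > 0 then 1 else 0

/-- The operation `∧` on natural numbers. -/
def natInf (m n : ℕ) : ℕ := if m > 0 ∧ n > 0 then 1 else 0

/-- The operation `¬` on natural numbers. -/
def natCompl (m : ℕ) : ℕ := if m = 0 then 1 else 0

/-! ### The language of Boolean algebras -/

/-- Terms of the language of Boolean algebras with `n` free variables. -/
inductive BTerm (n : ℕ) : Type
  | var (i : Fin n) : BTerm n
  | zero : BTerm n
  | one : BTerm n
  | sup (a b : BTerm n) : BTerm n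
  | inf (a b : BTerm n) : BTerm n
  | compl (a : BTerm n) : BTerm n

/-- Formulas of the language of Boolean algebras with `n` free variables; `BForm 0` is the set of
closed ones. -/
inductive BForm : ℕ → Type
  | top {n : ℕ} : BForm n
  | bot {n : ℕ} : BForm n
  | ne {n : ℕ} (a b : BTerm n) : BForm n
  | eq {n : ℕ} (a b : BTerm n) : BForm n
  | imp {n : ℕ} (A B : BForm n) : BForm n
  | or {n : ℕ} (A B : BForm n) : BForm n
  | and {n : ℕ} (A B : BForm n) : BForm n
  | all {n : ℕ} (A : BForm (n + 1)) : BForm n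

/-- Interpretation of a term in a Boolean algebra. -/
def BTerm.interp {B : Type*} [BooleanAlgebra B] {n : ℕ} (v : Fin n → B) : BTerm n → B
  | .var i => v i
  | .zero => ⊥
  | .one => ⊤
  | .sup a b => a.interp v ⊔ b.interp v
  | .inf a b => a.interp v ⊓ b.interp v
  | .compl a => (a.interp v)ᶜ

/-- Tarskian truth of a formula in a Boolean algebra. -/
def BForm.Sat {B : Type*} [BooleanAlgebra B] : {n : ℕ} → (Fin n → B) → BForm n → Prop
  | _, _, .top => True
  | _, _, .bot => False
  | _, v, .ne a b => a.interp v ≠ b.interp v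
  | _, v, .eq a b => a.interp v = b.interp v
  | _, v, .imp A C => A.Sat v → C.Sat v
  | _, v, .or A C => A.Sat v ∨ C.Sat v
  | _, v, .and A C => A.Sat v ∧ C.Sat v
  | n, v, .all A => ∀ x : B, A.Sat (Fin.cons x v : Fin (n + 1) → B)

/-- Truth of a closed formula in the Boolean algebra `B`. -/
def BForm.TrueIn (B : Type*) [BooleanAlgebra B] (A : BForm 0) : Prop :=
  A.Sat (Fin.elim0 : Fin 0 → B)

/-- A Boolean term as a first-order term of the realizability language. -/
def BTerm.toFOTerm {n : ℕ} : BTerm n → FOTerm n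
  | .var i => .var i
  | .zero => .nat 0
  | .one => .nat 1
  | .sup a b => .bin natSup a.toFOTerm b.toFOTerm
  | .inf a b => .bin natInf a.toFOTerm b.toFOTerm
  | .compl a => .un natCompl a.toFOTerm

/-- The relativization of `A` to gimel 2, as a formula of the realizability language. -/
def BForm.relGimel2 : {n : ℕ} → BForm n → Form n []
  | _, .top => .top
  | _, .bot => .bot
  | _, .ne a b => .ne a.toFOTerm b.toFOTerm
  | _, .eq a b => .eq a.toFOTerm b.toFOTerm
  | _, .imp A B => .imp A.relGimel2 B.relGimel2
  | _, .or A B => .or A.relGimel2 B.relGimel2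
  | _, .and A B => .and A.relGimel2 B.relGimel2
  | _, .all A => .allGimel 2 A.relGimel2

/-- The axioms of Boolean algebras with at least two elements: commutativity, associativity,
absorption, distributivity, complements, and `0 ≠ 1`. -/
def booleanAxioms : Set (BForm 0) :=
  let x : BTerm 3 := .var 0
  let y : BTerm 3 := .var 1
  let z : BTerm 3 := .var 2
  let close : BForm 3 → BForm 0 := fun A => .all (.all (.all A))
  { close (.eq (.sup x y) (.sup y x)),
    close (.eq (.inf x y) (.inf y x)),
    close (.eq (.sup (.sup x y) z) (.sup x (.sup y z))),
    close (.eq (.inf (.inf x y) z) (.inf x (.inf y z))),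
    close (.eq (.sup x (.inf x y)) x),
    close (.eq (.inf x (.sup x y)) x),
    close (.eq (.sup x (.inf y z)) (.inf (.sup x y) (.sup x z))),
    close (.eq (.inf x (.sup y z)) (.sup (.inf x y) (.inf x z))),
    close (.eq (.sup x (.compl x)) .one),
    close (.eq (.inf x (.compl x)) .zero),
    .ne .zero .one }

/-- According to the theory `T`, gimel 2 contains `0` and `1`, is closed under the operations, and
satisfies the axioms of Boolean algebras with at least two elements. -/
structure GimelTwoIsBooleanAlgebra (T : Set (Form 0 [])) : Prop where
  zero_mem : Form.gimel 2 (.nat 0) ∈ T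
  one_mem : Form.gimel 2 (.nat 1) ∈ T
  sup_mem : Form.allGimel 2 (.allGimel 2 (.gimel 2 (.bin natSup (.var 0) (.var 1)))) ∈ T
  inf_mem : Form.allGimel 2 (.allGimel 2 (.gimel 2 (.bin natInf (.var 0) (.var 1)))) ∈ T
  compl_mem : Form.allGimel 2 (.gimel 2 (.un natCompl (.var 0))) ∈ T
  axioms_mem : ∀ A ∈ booleanAxioms, A.relGimel2 ∈ T

end Realizability

namespace Realizability

/-! ### Substitution in closed terms -/

-- The first part is a completeness theorem for uniform realizability. Let polynomials over `ZMod 2`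
-- in countably many variables name the elements of gimel 2: a valuation `w` of the variables gives
-- each polynomial the value 0 or 1. A formula with such names becomes a family of falsity values
-- indexed by poles and valuations, and `Provable` asks for one proof-like term realizing the whole
-- family. Because of this uniformity a relativized quantifier behaves like a quantifier over all
-- polynomials, not just over the constants 0 and 1: a term realizing the instance at a fresh
-- variable realizes the universal statement (`provable_imp_all`).
--
-- Provability contains classical logic (`provable_K`, `provable_S`, `provable_of_neg_neg`) and all
-- pointwise valid equational reasoning (`provable_eq_imp_eq_imp_eq`). If `A` is not provable, its
-- negation is consistent. Since the language is countable, a Rasiowa–Sikorski argument extends it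
-- to a complete theory with Henkin witnesses (`Cond.exists_isGeneric`). The polynomials modulo
-- equality in this theory form a nontrivial Boolean algebra, in which truth is membership in the
-- theory (`IsGeneric.sat_iff`), so `A` fails there.
--
-- In the second part, the axioms follow from the first, and the closure conditions are realized by
-- the identity.

theorem Tm.subst_rename : ∀ {n m k : ℕ} (t : Tm n) (f : Fin n → Fin m) (s : Fin m → Tm k),
    (t.rename f).subst s = t.subst fun i => s (f i)
  | _, _, _, .var _, _, _ => by simp only [Tm.rename, Tm.subst]
  | _, _, _, .app t u, f, s => by
      simp only [Tm.rename, Tm.subst, Tm.subst_rename t, Tm.subst_rename u]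
  | _, _, _, .lam t, f, s => by
      simp only [Tm.rename, Tm.subst, Tm.subst_rename t]
      congr 2
      funext i
      refine Fin.cases ?_ (fun i => ?_) i <;> simp
  | _, _, _, .cc, _, _ => by simp only [Tm.rename, Tm.subst]
  | _, _, _, .cont _, _, _ => by simp only [Tm.rename, Tm.subst]
  | _, _, _, .freeInstr _, _, _ => by simp only [Tm.rename, Tm.subst]
  | _, _, _, .restrInstr _, _, _ => by simp only [Tm.rename, Tm.subst]

theorem Tm.rename_eq_subst : ∀ {n m : ℕ} (t : Tm n) (f : Fin n → Fin m),
    t.rename f = t.subst fun i => .var (f i)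
  | _, _, .var _, _ => by simp only [Tm.rename, Tm.subst]
  | _, _, .app t u, f => by
      simp only [Tm.rename, Tm.subst, Tm.rename_eq_subst t, Tm.rename_eq_subst u]
  | _, _, .lam t, f => by
      simp only [Tm.rename, Tm.subst, Tm.rename_eq_subst t]
      congr 2
      funext i
      refine Fin.cases ?_ (fun i => ?_) i <;> simp
  | _, _, .cc, _ => by simp only [Tm.rename, Tm.subst]
  | _, _, .cont _, _ => by simp only [Tm.rename, Tm.subst]
  | _, _, .freeInstr _, _ => by simp only [Tm.rename, Tm.subst]
  | _, _, .restrInstr _, _ => by simp only [Tm.rename, Tm.subst]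

theorem Tm.subst_var : ∀ {n : ℕ} (t : Tm n), t.subst Tm.var = t
  | _, .var _ => by simp only [Tm.subst]
  | _, .app t u => by simp only [Tm.subst, Tm.subst_var t, Tm.subst_var u]
  | n, .lam t => by
      have h : (Fin.cases (.var 0) fun i => (Tm.var i : Tm n).rename Fin.succ) = Tm.var := by
        funext i
        refine Fin.cases ?_ (fun i => ?_) i <;> simp [Tm.rename]
      simp only [Tm.subst]
      rw [h, Tm.subst_var t]
  | _, .cc => by simp only [Tm.subst]
  | _, .cont _ => by simp only [Tm.subst]
  | _, .freeInstr _ => by simp only [Tm.subst]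
  | _, .restrInstr _ => by simp only [Tm.subst]

/-- A closed term seen as a term with `n` free variables. -/
def Tm.lift (n : ℕ) (u : Tm 0) : Tm n := u.rename Fin.elim0

@[simp] theorem Tm.rename_closed {n : ℕ} (u : Tm 0) (f : Fin 0 → Fin n) :
    u.rename f = u.lift n := by
  rw [Tm.lift, Subsingleton.elim f Fin.elim0]

@[simp] theorem Tm.lift_subst {n m : ℕ} (u : Tm 0) (s : Fin n → Tm m) :
    (u.lift n).subst s = u.lift m := by
  rw [Tm.lift, Tm.lift, Tm.subst_rename, Tm.rename_eq_subst]
  congr 1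
  exact Subsingleton.elim _ _

@[simp] theorem Tm.lift_zero (u : Tm 0) : u.lift 0 = u := by
  rw [Tm.lift, Tm.rename_eq_subst, Subsingleton.elim (fun i => Tm.var _) Tm.var, Tm.subst_var]

@[simp] theorem Tm.lift_rename {n m : ℕ} (u : Tm 0) (f : Fin n → Fin m) :
    (u.lift n).rename f = u.lift m := by
  rw [Tm.rename_eq_subst, Tm.lift_subst]

theorem Pole.of_step (P : Pole) {p q : Proc} (h : Step p q) (hq : q ∈ P.carrier) :
    p ∈ P.carrier :=
  P.anti_eval p q (Relation.ReflTransGen.single h) hq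

theorem Pole.of_app (P : Pole) {t u : Tm 0} {π : Stk}
    (h : (⟨t, .cons u π⟩ : Proc) ∈ P.carrier) : (⟨.app t u, π⟩ : Proc) ∈ P.carrier :=
  P.of_step (.push t u π) h

theorem Pole.of_lam (P : Pole) {t : Tm 1} {u : Tm 0} {π : Stk}
    (h : (⟨t.subst fun _ => u, π⟩ : Proc) ∈ P.carrier) :
    (⟨.lam t, .cons u π⟩ : Proc) ∈ P.carrier :=
  P.of_step (.grab t u π) h

/-! ### Uniformly realized families of falsity values -/

/-- A falsity value for every pole, depending on a parameter in `W`. -/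
abbrev Fam (W : Type*) := Pole → W → Set Stk

/-- A single proof-like term realizes all members of the family. -/
def Provable {W : Type*} (X : Fam W) : Prop :=
  ∃ t : Tm 0, t.ProofLike ∧ ∀ (P : Pole) (w : W), t ∈ P.dual (X P w)

namespace Fam

variable {W : Type*}

/-- Falsehood. -/
def falsum : Fam W := fun _ _ => Set.univ

/-- Implication. -/
def imp (X Y : Fam W) : Fam W :=
  fun (P : Pole) (w : W) => {π | ∃ t ∈ P.dual (X P w), ∃ π' ∈ Y P w, π = Stk.cons t π'}

/-- Negation. -/
def neg (X : Fam W) : Fam W := X.imp falsum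

/-- Conjunction, by its second-order encoding. -/
protected def and (X Y : Fam W) : Fam W :=
  fun P w => ⋃ Z : Set Stk, imp (W := W) (X.imp (Y.imp fun _ _ => Z)) (fun _ _ => Z) P w

/-- Disjunction, by its second-order encoding. -/
protected def or (X Y : Fam W) : Fam W :=
  fun P w => ⋃ Z : Set Stk,
    imp (W := W) (X.imp fun _ _ => Z) ((Y.imp fun _ _ => Z).imp fun _ _ => Z) P w

/-- Leibniz equality of two functions of the parameter. -/
protected def eq (a b : W → ℕ) : Fam W :=
  fun P w => ⋃ F : ℕ → Set Stk, imp (W := W) (fun _ w => F (a w)) (fun _ w => F (b w)) P w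

/-- Disequality of two functions of the parameter. -/
protected def ne (a b : W → ℕ) : Fam W := fun _ w => {_π | a w = b w}

end Fam

theorem Pole.cons_mem {P : Pole} {W : Type*} {X Y : Fam W} {w : W} {t u : Tm 0} {π : Stk}
    (ht : t ∈ P.dual (X.imp Y P w)) (hu : u ∈ P.dual (X P w)) (hπ : π ∈ Y P w) :
    (⟨t, .cons u π⟩ : Proc) ∈ P.carrier :=
  ht _ ⟨u, hu, π, hπ, rfl⟩

theorem Pole.app_mem_dual {P : Pole} {W : Type*} {X Y : Fam W} {w : W} {t u : Tm 0}
    (ht : t ∈ P.dual (X.imp Y P w)) (hu : u ∈ P.dual (X P w)) :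
    Tm.app t u ∈ P.dual (Y P w) :=
  fun _ hπ => P.of_app (Pole.cons_mem ht hu hπ)

/-- The identity. -/
def Tm.id : Tm 0 := .lam (.var 0)

theorem Pole.id_mem (P : Pole) {u : Tm 0} {π : Stk} (h : (⟨u, π⟩ : Proc) ∈ P.carrier) :
    (⟨Tm.id, .cons u π⟩ : Proc) ∈ P.carrier :=
  P.of_lam (by simpa [Tm.subst] using h)

-- With the next lemma, lets `simp` evaluate substitutions at the de Bruijn indices 1 and 2, which
-- are numerals and not syntactic successors.
@[simp] theorem fin_cases_one {α : Type*} {n : ℕ} (a : α) (f : Fin (n + 1) → α) :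
    Fin.cases (motive := fun _ => α) a f 1 = f 0 := rfl

@[simp] theorem fin_cases_two {α : Type*} {n : ℕ} (a : α) (f : Fin (n + 2) → α) :
    Fin.cases (motive := fun _ => α) a f 2 = f 1 := rfl

variable {W : Type*} {X Y Z : Fam W}

-- Realizers of classical propositional logic

theorem Provable.mp (h : Provable (X.imp Y)) (hX : Provable X) : Provable Y := by
  obtain ⟨t, ht, h⟩ := h
  obtain ⟨u, hu, hX⟩ := hX
  exact ⟨.app t u, by simp [Tm.ProofLike, ht, hu], fun P w => P.app_mem_dual (h P w) (hX P w)⟩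

theorem provable_imp_of_subset (h : ∀ P w, Y P w ⊆ X P w) : Provable (X.imp Y) := by
  refine ⟨Tm.id, by simp [Tm.id, Tm.ProofLike], ?_⟩
  rintro P w _ ⟨u, hu, π, hπ, rfl⟩
  exact P.id_mem (hu _ (h P w hπ))

theorem provable_K (X Y : Fam W) : Provable (X.imp (Y.imp X)) := by
  refine ⟨.lam (.lam (.var 1)), by simp [Tm.ProofLike], ?_⟩
  rintro P w _ ⟨x, hx, _, ⟨y, hy, π, hπ, rfl⟩, rfl⟩
  refine P.of_lam (P.of_lam ?_)
  simpa [Tm.subst] using hx _ hπ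

theorem provable_S (X Y Z : Fam W) :
    Provable ((X.imp (Y.imp Z)).imp ((X.imp Y).imp (X.imp Z))) := by
  refine ⟨.lam (.lam (.lam (.app (.app (.var 2) (.var 0)) (.app (.var 1) (.var 0))))),
    by simp [Tm.ProofLike], ?_⟩
  rintro P w _ ⟨f, hf, _, ⟨g, hg, _, ⟨x, hx, π, hπ, rfl⟩, rfl⟩, rfl⟩
  refine P.of_lam (P.of_lam (P.of_lam ?_))
  simp only [Tm.subst]
  refine P.of_app ?_
  simpa [Tm.subst, Tm.rename] using P.of_app <|
    Pole.cons_mem hf hx ⟨_, P.app_mem_dual hg hx, π, hπ, rfl⟩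

/-- When `cc` runs against a stack in the falsity value of `X`, the saved continuation sends every
realizer of `X` to that stack, hence realizes the negation of `X`. -/
theorem provable_of_neg_neg (X : Fam W) : Provable (X.neg.neg.imp X) := by
  refine ⟨.cc, by simp [Tm.ProofLike], ?_⟩
  rintro P w _ ⟨f, hf, π, hπ, rfl⟩
  refine P.of_step (.save _ _) (Pole.cons_mem hf ?_ trivial)
  rintro _ ⟨x, hx, π', -, rfl⟩
  exact P.of_step (.restore _ _ _) (hx _ hπ)

theorem provable_and_intro (X Y : Fam W) : Provable (X.imp (Y.imp (X.and Y))) := by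
  refine ⟨.lam (.lam (.lam (.app (.app (.var 0) (.var 2)) (.var 1)))),
    by simp [Tm.ProofLike], ?_⟩
  rintro P w _ ⟨x, hx, _, ⟨y, hy, _, hπ', rfl⟩, rfl⟩
  obtain ⟨Z, f, hf, π, hπ, rfl⟩ := Set.mem_iUnion.1 hπ'
  refine P.of_lam (P.of_lam (P.of_lam ?_))
  simp only [Tm.subst]
  refine P.of_app (P.of_app ?_)
  simpa [Tm.subst, Tm.rename] using Pole.cons_mem hf hx ⟨y, hy, π, hπ, rfl⟩

theorem provable_and_elim (X Y Z : Fam W) :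
    Provable ((X.imp (Y.imp Z)).imp ((X.and Y).imp Z)) := by
  refine ⟨.lam (.lam (.app (.var 0) (.var 1))), by simp [Tm.ProofLike], ?_⟩
  rintro P w _ ⟨f, hf, _, ⟨p, hp, π, hπ, rfl⟩, rfl⟩
  refine P.of_lam (P.of_lam ?_)
  simp only [Tm.subst]
  refine P.of_app ?_
  simpa [Tm.subst] using hp _ (Set.mem_iUnion.2 ⟨Z P w, f, hf, π, hπ, rfl⟩)

theorem provable_or_inl (X Y : Fam W) : Provable (X.imp (X.or Y)) := by
  refine ⟨.lam (.lam (.lam (.app (.var 1) (.var 2)))), by simp [Tm.ProofLike], ?_⟩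
  rintro P w _ ⟨x, hx, _, hπ', rfl⟩
  obtain ⟨Z, f, hf, _, ⟨g, hg, π, hπ, rfl⟩, rfl⟩ := Set.mem_iUnion.1 hπ'
  refine P.of_lam (P.of_lam (P.of_lam ?_))
  simp only [Tm.subst]
  refine P.of_app ?_
  simpa [Tm.subst, Tm.rename] using Pole.cons_mem hf hx hπ

theorem provable_or_inr (X Y : Fam W) : Provable (Y.imp (X.or Y)) := by
  refine ⟨.lam (.lam (.lam (.app (.var 0) (.var 2)))), by simp [Tm.ProofLike], ?_⟩
  rintro P w _ ⟨y, hy, _, hπ', rfl⟩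
  obtain ⟨Z, f, hf, _, ⟨g, hg, π, hπ, rfl⟩, rfl⟩ := Set.mem_iUnion.1 hπ'
  refine P.of_lam (P.of_lam (P.of_lam ?_))
  simp only [Tm.subst]
  refine P.of_app ?_
  simpa [Tm.subst, Tm.rename] using Pole.cons_mem hg hy hπ

theorem provable_or_elim (X Y Z : Fam W) :
    Provable ((X.imp Z).imp ((Y.imp Z).imp ((X.or Y).imp Z))) := by
  refine ⟨.lam (.lam (.lam (.app (.app (.var 0) (.var 2)) (.var 1)))),
    by simp [Tm.ProofLike], ?_⟩
  rintro P w _ ⟨f, hf, _, ⟨g, hg, _, ⟨d, hd, π, hπ, rfl⟩, rfl⟩, rfl⟩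
  refine P.of_lam (P.of_lam (P.of_lam ?_))
  simp only [Tm.subst]
  refine P.of_app (P.of_app ?_)
  simpa [Tm.subst, Tm.rename] using
    hd _ (Set.mem_iUnion.2 ⟨Z P w, f, hf, _, ⟨g, hg, π, hπ, rfl⟩, rfl⟩)

/-! ### Equality -/

/-- Applying a realizer of an equation to `u` lets one assume that the equation is true when
checking `u`. All elimination of Leibniz equality goes through this lemma. -/
theorem Pole.app_mem_of_mem_dual_eq {P : Pole} {a b : W → ℕ} {w : W} {e u : Tm 0} {Z : Set Stk}
    (he : e ∈ P.dual (Fam.eq a b P w)) (hu : a w = b w → u ∈ P.dual Z) :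
    Tm.app e u ∈ P.dual Z := by
  intro π hπ
  refine P.of_app (he _ (Set.mem_iUnion.2 ?_))
  by_cases h : a w = b w
  · exact ⟨fun _ => Z, u, hu h, π, hπ, rfl⟩
  -- This predicate is empty at `a w`, where every term realizes it, and contains all stacks at `b
  -- w`.
  · exact ⟨fun n => {_π | n = b w}, u, fun _ h' => (h h').elim, π, rfl, rfl⟩

theorem id_mem_dual_eq (P : Pole) {a b : W → ℕ} {w : W} (h : a w = b w) :
    Tm.id ∈ P.dual (Fam.eq a b P w) := by
  intro π hπ
  obtain ⟨F, u, hu, π, hπ', rfl⟩ := Set.mem_iUnion.1 hπ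
  exact P.id_mem (hu _ (by simpa only [h] using hπ'))

theorem provable_eq {a b : W → ℕ} (h : ∀ w, a w = b w) : Provable (Fam.eq a b) :=
  ⟨Tm.id, by simp [Tm.id, Tm.ProofLike], fun P w => id_mem_dual_eq P (h w)⟩

theorem provable_neg_eq {a b : W → ℕ} (h : ∀ w, a w ≠ b w) : Provable (Fam.eq a b).neg := by
  refine ⟨.lam (.app (.var 0) (.var 0)), by simp [Tm.ProofLike], ?_⟩
  rintro P w _ ⟨e, he, π, hπ, rfl⟩
  refine P.of_lam ?_
  simp only [Tm.subst]
  exact Pole.app_mem_of_mem_dual_eq he (fun h' => (h w h').elim) _ hπ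

/-- The realizer does not depend on the functions: it composes the two given equalities, and the
entailment is used only when both equations are true. -/
theorem provable_eq_imp_eq_imp_eq {a b a' b' c d : W → ℕ}
    (h : ∀ w, a w = b w → a' w = b' w → c w = d w) :
    Provable ((Fam.eq a b).imp ((Fam.eq a' b').imp (Fam.eq c d))) := by
  refine ⟨.lam (.lam (.lam (.app (.var 2) (.app (.var 1) (.var 0))))),
    by simp [Tm.ProofLike], ?_⟩
  rintro P w _ ⟨e, he, _, ⟨e', he', _, hπ', rfl⟩, rfl⟩
  obtain ⟨F, u, hu, π, hπ, rfl⟩ := Set.mem_iUnion.1 hπ'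
  refine P.of_lam (P.of_lam (P.of_lam ?_))
  have key : Tm.app e (.app e' u) ∈ P.dual (F (d w)) :=
    Pole.app_mem_of_mem_dual_eq he fun h₁ =>
      Pole.app_mem_of_mem_dual_eq he' fun h₂ => h w h₁ h₂ ▸ hu
  simpa [Tm.subst, Tm.rename] using key _ hπ

theorem provable_ne_imp_neg_eq (a b : W → ℕ) : Provable ((Fam.ne a b).imp (Fam.eq a b).neg) := by
  refine ⟨.lam (.lam (.app (.var 0) (.var 1))), by simp [Tm.ProofLike], ?_⟩
  rintro P w _ ⟨u, hu, _, ⟨e, he, π, hπ, rfl⟩, rfl⟩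
  refine P.of_lam (P.of_lam ?_)
  have key : Tm.app e u ∈ P.dual Set.univ :=
    Pole.app_mem_of_mem_dual_eq he fun h π _ => hu π h
  simpa [Tm.subst] using key _ hπ

/-- A stack to be tested exists only when the equation is true, and then the identity realizes it.
-/
theorem provable_neg_eq_imp_ne (a b : W → ℕ) : Provable ((Fam.eq a b).neg.imp (Fam.ne a b)) := by
  refine ⟨.lam (.app (.var 0) (.lam (.var 0))), by simp [Tm.ProofLike], ?_⟩
  rintro P w _ ⟨f, hf, π, hπ, rfl⟩
  refine P.of_lam (P.of_app ?_)
  simpa [Tm.subst, Tm.id] using Pole.cons_mem hf (id_mem_dual_eq P hπ) trivial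

/-! ### Derived rules -/

theorem Provable.imp_trans (h₁ : Provable (X.imp Y)) (h₂ : Provable (Y.imp Z)) :
    Provable (X.imp Z) :=
  ((provable_S X Y Z).mp ((provable_K _ X).mp h₂)).mp h₁

theorem Provable.imp_mp (h₁ : Provable (X.imp (Y.imp Z))) (h₂ : Provable (X.imp Y)) :
    Provable (X.imp Z) :=
  ((provable_S X Y Z).mp h₁).mp h₂

theorem Provable.weaken (h : Provable Y) (X : Fam W) : Provable (X.imp Y) :=
  (provable_K Y X).mp h

theorem provable_imp_self (X : Fam W) : Provable (X.imp X) :=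
  provable_imp_of_subset fun _ _ => subset_rfl

theorem provable_and_left (X Y : Fam W) : Provable ((X.and Y).imp X) :=
  (provable_and_elim X Y X).mp (provable_K X Y)

theorem provable_and_right (X Y : Fam W) : Provable ((X.and Y).imp Y) :=
  (provable_and_elim X Y Y).mp ((provable_imp_self Y).weaken X)

theorem Provable.curry (h : Provable ((X.and Y).imp Z)) : Provable (X.imp (Y.imp Z)) :=
  (provable_and_intro X Y).imp_trans ((provable_S _ _ _).mp (h.weaken Y))

theorem provable_falsum_imp (X : Fam W) : Provable (Fam.falsum.imp X) :=
  provable_imp_of_subset fun _ _ => Set.subset_univ _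

theorem provable_neg_imp_imp (X Y : Fam W) : Provable (X.neg.imp (X.imp Y)) :=
  (provable_S _ _ _).mp ((provable_falsum_imp Y).weaken X)

/-! ### Countability of the language of Boolean algebras -/

/-- A numbering of the terms. -/
def BTerm.code {n : ℕ} : BTerm n → ℕ
  | .var i => Nat.pair 0 i
  | .zero => Nat.pair 1 0
  | .one => Nat.pair 2 0
  | .sup a b => Nat.pair 3 (Nat.pair a.code b.code)
  | .inf a b => Nat.pair 4 (Nat.pair a.code b.code)
  | .compl a => Nat.pair 5 a.code

theorem BTerm.code_injective {n : ℕ} : Function.Injective (BTerm.code (n := n)) := by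
  intro a
  induction a with
  | var i => intro b h; cases b <;> simp_all [BTerm.code, Fin.ext_iff]
  | zero => intro b h; cases b <;> simp_all [BTerm.code]
  | one => intro b h; cases b <;> simp_all [BTerm.code]
  | sup a₁ a₂ h₁ h₂ =>
    intro b h; cases b <;> simp [BTerm.code] at h ⊢; exact ⟨h₁ h.1, h₂ h.2⟩
  | inf a₁ a₂ h₁ h₂ =>
    intro b h; cases b <;> simp [BTerm.code] at h ⊢; exact ⟨h₁ h.1, h₂ h.2⟩
  | compl a h₁ => intro b h; cases b <;> simp [BTerm.code] at h ⊢; exact h₁ h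

/-- A numbering of the formulas. -/
def BForm.code : {n : ℕ} → BForm n → ℕ
  | _, .top => Nat.pair 0 0
  | _, .bot => Nat.pair 1 0
  | _, .ne a b => Nat.pair 2 (Nat.pair a.code b.code)
  | _, .eq a b => Nat.pair 3 (Nat.pair a.code b.code)
  | _, .imp A B => Nat.pair 4 (Nat.pair A.code B.code)
  | _, .or A B => Nat.pair 5 (Nat.pair A.code B.code)
  | _, .and A B => Nat.pair 6 (Nat.pair A.code B.code)
  | _, .all A => Nat.pair 7 A.code

theorem BForm.code_injective {n : ℕ} : Function.Injective (BForm.code (n := n)) := by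
  intro A
  induction A with
  | top => intro B h; cases B <;> simp_all [BForm.code]
  | bot => intro B h; cases B <;> simp_all [BForm.code]
  | ne a b | eq a b =>
    intro B h; cases B <;> simp [BForm.code] at h ⊢
    exact ⟨BTerm.code_injective h.1, BTerm.code_injective h.2⟩
  | imp A₁ A₂ h₁ h₂ | or A₁ A₂ h₁ h₂ | and A₁ A₂ h₁ h₂ =>
    intro B h; cases B <;> simp [BForm.code] at h ⊢; exact ⟨h₁ h.1, h₂ h.2⟩
  | all A h₁ => intro B h; cases B <;> simp [BForm.code] at h ⊢; exact h₁ h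

instance (n : ℕ) : Countable (BForm n) := BForm.code_injective.countable

/-! ### Substitution of Boolean polynomials in formulas -/

/-- Boolean polynomials in countably many variables. -/
abbrev Poly := MvPolynomial ℕ (ZMod 2)

instance : Countable Poly :=
  Cardinal.mk_le_aleph0_iff.1 (MvPolynomial.cardinalMk_le_max.trans (by simp))

/-- The integer value, `0` or `1`, of a Boolean polynomial. -/
noncomputable def Poly.value (f : Poly) (w : ℕ → ZMod 2) : ℕ := (MvPolynomial.eval w f).val

/-- The Boolean polynomial obtained by substituting `e` for the variables of a term. -/
noncomputable def BTerm.poly {n : ℕ} (e : Fin n → Poly) : BTerm n → Poly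
  | .var i => e i
  | .zero => 0
  | .one => 1
  | .sup a b => a.poly e + b.poly e + a.poly e * b.poly e
  | .inf a b => a.poly e * b.poly e
  | .compl a => 1 + a.poly e

/-- On the values 0 and 1 the integer operations agree with the polynomial operations of `ZMod 2`.
-/
theorem BTerm.value_toFOTerm {n : ℕ} (e : Fin n → Poly) (w : ℕ → ZMod 2) (a : BTerm n) :
    a.toFOTerm.value (fun i => (e i).value w) = (a.poly e).value w := by
  have hsup : ∀ x y : ZMod 2, natSup x.val y.val = (x + y + x * y).val := by decide
  have hinf : ∀ x y : ZMod 2, natInf x.val y.val = (x * y).val := by decide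
  have hcompl : ∀ x : ZMod 2, natCompl x.val = (1 + x).val := by decide
  induction a with
  | var i => rfl
  | zero => simp [BTerm.toFOTerm, FOTerm.nat, FOTerm.value, BTerm.poly, Poly.value]
  | one => simp [BTerm.toFOTerm, FOTerm.nat, FOTerm.value, BTerm.poly, Poly.value, ZMod.val_one]
  | sup a b ha hb =>
    simp [BTerm.toFOTerm, FOTerm.bin, FOTerm.value, BTerm.poly, ha, hb]
    simp [Poly.value, hsup]
  | inf a b ha hb =>
    simp [BTerm.toFOTerm, FOTerm.bin, FOTerm.value, BTerm.poly, ha, hb]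
    simp [Poly.value, hinf]
  | compl a ha =>
    simp [BTerm.toFOTerm, FOTerm.un, FOTerm.value, BTerm.poly, ha]
    simp [Poly.value, hcompl]

/-- The falsity values of the relativization of `A` to gimel 2, the Boolean polynomials `e` being
substituted for its free variables. -/
noncomputable def BForm.fam {n : ℕ} (A : BForm n) (e : Fin n → Poly) : Fam (ℕ → ZMod 2) :=
  fun P w => A.relGimel2.falsity P (fun i => (e i).value w) PVal.nil

theorem Form.falsity_rename (P : Pole) {n : ℕ} {Γ Δ : List ℕ} (A : Form n Γ)
    (f : (k : ℕ) → PVar Γ k → PVar Δ k) (ρ : Fin n → ℕ) (σ : PVal Δ) :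
    (A.rename f).falsity P ρ σ = A.falsity P ρ fun k X => σ k (f k X) := by
  induction A generalizing Δ with
  | pvar X a => rfl
  | top => rfl
  | bot => rfl
  | imp A B hA hB => simp only [Form.rename, Form.falsity, hA, hB]
  | all A hA => simp only [Form.rename, Form.falsity, hA]
  | allP k A hA =>
    simp only [Form.rename, Form.falsity, hA]
    refine Set.iUnion_congr fun F => ?_
    congr 1
    funext l X
    cases X <;> rfl
  | eqImp a b A hA => simp only [Form.rename, Form.falsity, hA]
  | inter A B hA hB => simp only [Form.rename, Form.falsity, hA, hB]
  | union A B hA hB => simp only [Form.rename, Form.falsity, hA, hB]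
  | const F a => rfl

theorem Form.falsity_weaken (P : Pole) {n : ℕ} {Γ : List ℕ} (A : Form n Γ) (l : ℕ)
    (ρ : Fin n → ℕ) (F : (Fin l → ℕ) → Set Stk) (σ : PVal Γ) :
    (A.weaken l).falsity P ρ (PVal.cons F σ) = A.falsity P ρ σ :=
  Form.falsity_rename P A _ ρ _

theorem Form.falsity_eq (P : Pole) {n : ℕ} {Γ : List ℕ} (a b : FOTerm n) (ρ : Fin n → ℕ)
    (σ : PVal Γ) :
    (Form.eq a b : Form n Γ).falsity P ρ σ = Fam.eq a.value b.value P ρ := by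
  ext π
  simp only [Form.eq, Form.falsity, Fam.eq, Set.mem_iUnion]
  constructor
  · rintro ⟨F, h⟩
    have hv : ∀ c : FOTerm n, (fun j => FOTerm.value ρ (![c] j)) = ![c.value ρ] := fun c =>
      funext fun j => by rw [Subsingleton.elim j 0]; rfl
    simp only [hv] at h
    exact ⟨fun m => F ![m], h⟩
  · rintro ⟨F, h⟩
    exact ⟨fun v => F (v 0), h⟩

namespace BForm

variable {n : ℕ} (e : Fin n → Poly)

/-- This and the following clauses identify the encoded connectives with those of `Fam`, so that the
realizers above apply. -/
theorem fam_ne (a b : BTerm n) :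
    (BForm.ne a b).fam e = Fam.ne (a.poly e).value (b.poly e).value := by
  funext P w
  simp [BForm.fam, BForm.relGimel2, Form.ne, Form.falsity, BTerm.value_toFOTerm, Fam.ne]

theorem fam_eq (a b : BTerm n) :
    (BForm.eq a b).fam e = Fam.eq (a.poly e).value (b.poly e).value := by
  funext P w
  simp only [BForm.fam, BForm.relGimel2, Form.falsity_eq, Fam.eq, Fam.imp, BTerm.value_toFOTerm]

theorem fam_imp (A B : BForm n) : (A.imp B).fam e = (A.fam e).imp (B.fam e) := rfl

theorem fam_and (A B : BForm n) : (A.and B).fam e = (A.fam e).and (B.fam e) := by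
  funext P w
  ext π
  simp only [BForm.fam, BForm.relGimel2, Form.and, Form.falsity, Form.falsity_weaken, Fam.and,
    Set.mem_iUnion]
  constructor
  · rintro ⟨F, h⟩
    exact ⟨_, h⟩
  · rintro ⟨Z, h⟩
    exact ⟨fun _ => Z, h⟩

theorem fam_or (A B : BForm n) : (A.or B).fam e = (A.fam e).or (B.fam e) := by
  funext P w
  ext π
  simp only [BForm.fam, BForm.relGimel2, Form.or, Form.falsity, Form.falsity_weaken, Fam.or,
    Set.mem_iUnion]
  constructor
  · rintro ⟨F, h⟩
    exact ⟨_, h⟩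
  · rintro ⟨Z, h⟩
    exact ⟨fun _ => Z, h⟩

theorem fam_cons (A : BForm (n + 1)) (f : Poly) (P : Pole) (w : ℕ → ZMod 2) :
    A.fam (Fin.cons f e : Fin (n + 1) → Poly) P w =
      A.relGimel2.falsity P (Fin.cons (f.value w) fun i => (e i).value w : Fin (n + 1) → ℕ)
        PVal.nil := by
  unfold BForm.fam
  congr 1
  funext i
  refine Fin.cases ?_ (fun i => ?_) i <;> rfl

/-- The relativizing condition `min (m + 1) 2 = m + 1` leaves only the integers 0 and 1. -/
theorem mem_fam_all (A : BForm (n + 1)) (P : Pole) (w : ℕ → ZMod 2) (π : Stk) :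
    π ∈ A.all.fam e P w ↔ ∃ m < 2, π ∈
      A.relGimel2.falsity P (Fin.cons m fun i => (e i).value w : Fin (n + 1) → ℕ) PVal.nil := by
  simp [BForm.fam, BForm.relGimel2, Form.allGimel, Form.falsity, FOTerm.value, FOTerm.succ,
    FOTerm.bin, FOTerm.nat]

theorem fam_cons_subset (A : BForm (n + 1)) (f : Poly) (P : Pole) (w : ℕ → ZMod 2) :
    A.fam (Fin.cons f e : Fin (n + 1) → Poly) P w ⊆ A.all.fam e P w := by
  intro π hπ
  rw [fam_cons] at hπ
  exact (mem_fam_all e A P w π).2 ⟨_, ZMod.val_lt _, hπ⟩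

end BForm

/-! ### Finite support -/

/-- The family depends only on the variables in `s`. -/
def Fam.SupportedOn (X : Fam (ℕ → ZMod 2)) (s : Finset ℕ) : Prop :=
  ∀ ⦃w w' : ℕ → ZMod 2⦄, (∀ i ∈ s, w i = w' i) → ∀ P, X P w = X P w'

theorem Fam.SupportedOn.mono {X : Fam (ℕ → ZMod 2)} {s t : Finset ℕ} (h : X.SupportedOn s)
    (hst : s ⊆ t) : X.SupportedOn t :=
  fun _ _ hw => h fun i hi => hw i (hst hi)

theorem Fam.SupportedOn.imp {X Y : Fam (ℕ → ZMod 2)} {s : Finset ℕ} (hX : X.SupportedOn s)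
    (hY : Y.SupportedOn s) : (X.imp Y).SupportedOn s := by
  intro w w' hw P
  simp only [Fam.imp, hX hw, hY hw]

theorem Fam.SupportedOn.neg {X : Fam (ℕ → ZMod 2)} {s : Finset ℕ} (hX : X.SupportedOn s) :
    X.neg.SupportedOn s :=
  hX.imp fun _ _ _ _ => rfl

theorem Fam.SupportedOn.and {X Y : Fam (ℕ → ZMod 2)} {s : Finset ℕ} (hX : X.SupportedOn s)
    (hY : Y.SupportedOn s) : (X.and Y).SupportedOn s := by
  intro w w' hw P
  simp only [Fam.and, Fam.imp, hX hw, hY hw]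

theorem Poly.value_congr (f : Poly) {w w' : ℕ → ZMod 2} (h : ∀ i ∈ f.vars, w i = w' i) :
    f.value w = f.value w' := by
  unfold Poly.value
  congr 1
  exact MvPolynomial.hom_congr_vars (by ext; simp) (fun i hi _ => by simpa using h i hi) rfl

/-- The variables occurring in a tuple of polynomials. -/
noncomputable def Poly.support {n : ℕ} (e : Fin n → Poly) : Finset ℕ :=
  Finset.univ.biUnion fun i => (e i).vars

theorem Poly.value_congr_of_support {n : ℕ} {e : Fin n → Poly} {w w' : ℕ → ZMod 2}
    (h : ∀ i ∈ Poly.support e, w i = w' i) :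
    (fun i => (e i).value w) = fun i => (e i).value w' :=
  funext fun i => (e i).value_congr fun j hj =>
    h j (Finset.mem_biUnion.2 ⟨i, Finset.mem_univ _, hj⟩)

theorem BForm.fam_supportedOn {n : ℕ} (A : BForm n) (e : Fin n → Poly) :
    (A.fam e).SupportedOn (Poly.support e) := by
  intro w w' hw P
  simp only [BForm.fam, Poly.value_congr_of_support hw]

/-- Generalization: if `y` is fresh, what is provable of `y` is provable of every element. -/
theorem provable_imp_all {X : Fam (ℕ → ZMod 2)} {s : Finset ℕ} (hX : X.SupportedOn s) {n : ℕ}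
    (A : BForm (n + 1)) (e : Fin n → Poly) {y : ℕ} (hys : y ∉ s) (hye : y ∉ Poly.support e)
    (h : Provable (X.imp (A.fam (Fin.cons (MvPolynomial.X y) e : Fin (n + 1) → Poly)))) :
    Provable (X.imp (A.all.fam e)) := by
  obtain ⟨t, ht, h⟩ := h
  refine ⟨t, ht, ?_⟩
  rintro P w _ ⟨u, hu, π, hπ, rfl⟩
  obtain ⟨m, hm, hπ⟩ := (BForm.mem_fam_all e A P w π).1 hπ
  -- Resetting the coordinate `y` to `m` gives the fresh variable the value `m` and changes neither
  -- `X` nor the parameters `e`.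
  have hw : ∀ r : Finset ℕ, y ∉ r → ∀ i ∈ r, w i = Function.update w y (m : ZMod 2) i :=
    fun r hr i hi => (Function.update_of_ne (ne_of_mem_of_not_mem hi hr) _ _).symm
  refine Pole.cons_mem (h P (Function.update w y m)) (hX (hw s hys) P ▸ hu) ?_
  rw [BForm.fam_cons, ← Poly.value_congr_of_support (hw _ hye)]
  simpa [Poly.value, ZMod.val_natCast_of_lt hm] using hπ

/-! ### Generic theories -/

/-- Consistent finitely supported families. -/
structure Cond where
  fam : Fam (ℕ → ZMod 2)
  supported : ∃ s, fam.SupportedOn s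
  consistent : ¬ Provable fam.neg

/-- Larger conditions are stronger, so cofinal sets play the role of dense sets. -/
instance : Preorder Cond where
  le c d := Provable (d.fam.imp c.fam)
  le_refl c := provable_imp_self c.fam
  le_trans _ _ _ h₁ h₂ := h₂.imp_trans h₁

theorem Cond.exists_and (c : Cond) {X : Fam (ℕ → ZMod 2)} (hX : ∃ s, X.SupportedOn s)
    (h : ¬ Provable (c.fam.imp X.neg)) : ∃ d : Cond, c ≤ d ∧ Provable (d.fam.imp X) := by
  obtain ⟨s, hs⟩ := c.supported
  obtain ⟨r, hr⟩ := hX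
  refine ⟨⟨c.fam.and X, ⟨s ∪ r, ?_⟩, fun h' => h h'.curry⟩, provable_and_left _ _,
    provable_and_right _ _⟩
  exact (hs.mono Finset.subset_union_left).and (hr.mono Finset.subset_union_right)

/-- A complete consistent set of families, with counterexamples to every universal statement that
fails. -/
structure IsGeneric (T : Set (Fam (ℕ → ZMod 2))) : Prop where
  of_provable : ∀ {X}, Provable X → X ∈ T
  mp : ∀ {X Y}, X.imp Y ∈ T → X ∈ T → Y ∈ T
  consistent : Fam.falsum ∉ T
  decides : ∀ {n : ℕ} (A : BForm n) (e : Fin n → Poly), A.fam e ∈ T ∨ (A.fam e).neg ∈ T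
  witness : ∀ {n : ℕ} (A : BForm (n + 1)) (e : Fin n → Poly), A.all.fam e ∈ T ∨
    ∃ f : Poly, (A.fam (Fin.cons f e : Fin (n + 1) → Poly)).neg ∈ T

theorem isCofinal_decides {n : ℕ} (A : BForm n) (e : Fin n → Poly) :
    IsCofinal {c : Cond | Provable (c.fam.imp (A.fam e)) ∨ Provable (c.fam.imp (A.fam e).neg)} := by
  intro c
  by_cases h : Provable (c.fam.imp (A.fam e).neg)
  · exact ⟨c, .inr h, le_rfl⟩
  · obtain ⟨d, hcd, hd⟩ := c.exists_and ⟨_, A.fam_supportedOn e⟩ h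
    exact ⟨d, .inl hd, hcd⟩

/-- The Henkin step: a fresh variable can be added as a counterexample, since refuting it would
prove the universal statement by generalization. -/
theorem isCofinal_witness {n : ℕ} (A : BForm (n + 1)) (e : Fin n → Poly) :
    IsCofinal {c : Cond | Provable (c.fam.imp (A.all.fam e)) ∨ ∃ f : Poly,
      Provable (c.fam.imp (A.fam (Fin.cons f e : Fin (n + 1) → Poly)).neg)} := by
  intro c
  by_cases h : Provable (c.fam.imp (A.all.fam e))
  · exact ⟨c, .inl h, le_rfl⟩
  · obtain ⟨s, hs⟩ := c.supported
    obtain ⟨y, hy⟩ := Infinite.exists_notMem_finset (s ∪ Poly.support e)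
    rw [Finset.mem_union, not_or] at hy
    obtain ⟨d, hcd, hd⟩ := c.exists_and
      ⟨_, (A.fam_supportedOn (Fin.cons (MvPolynomial.X y) e : Fin (n + 1) → Poly)).neg⟩
      fun h' => h (provable_imp_all hs A e hy.1 hy.2 (h'.imp_trans (provable_of_neg_neg _)))
    exact ⟨d, .inr ⟨_, hd⟩, hcd⟩

/-- A consistent family belongs to a generic theory. -/
theorem Cond.exists_isGeneric (c : Cond) : ∃ T, IsGeneric T ∧ c.fam ∈ T := by
  -- There are countably many requirements: formulas to decide on the left, quantifiers to witness
  -- on the right.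
  let ι := Σ n : ℕ, (BForm n × (Fin n → Poly)) ⊕ (BForm (n + 1) × (Fin n → Poly))
  let : Encodable ι := Encodable.ofCountable ι
  let D : ι → Order.Cofinal Cond
    | ⟨_, .inl (A, e)⟩ => ⟨_, isCofinal_decides A e⟩
    | ⟨_, .inr (A, e)⟩ => ⟨_, isCofinal_witness A e⟩
  let I := Order.idealOfCofinals c D
  refine ⟨{X | ∃ d ∈ I, Provable (d.fam.imp X)}, ⟨?_, ?_, ?_, ?_, ?_⟩,
    c, Order.mem_idealOfCofinals c D, provable_imp_self _⟩
  · exact fun h => ⟨c, Order.mem_idealOfCofinals c D, h.weaken _⟩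
  · rintro X Y ⟨d₁, hd₁, h₁⟩ ⟨d₂, hd₂, h₂⟩
    obtain ⟨d, hd, hd₁', hd₂'⟩ := I.directed d₁ hd₁ d₂ hd₂
    exact ⟨d, hd, (Provable.imp_trans hd₁' h₁).imp_mp (Provable.imp_trans hd₂' h₂)⟩
  · rintro ⟨d, -, h⟩
    exact d.consistent h
  · intro n A e
    obtain ⟨d, hd, hdI⟩ := Order.cofinal_meets_idealOfCofinals c D ⟨n, .inl (A, e)⟩
    exact hd.imp (fun h => ⟨d, hdI, h⟩) fun h => ⟨d, hdI, h⟩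
  · intro n A e
    obtain ⟨d, hd, hdI⟩ := Order.cofinal_meets_idealOfCofinals c D ⟨n, .inr (A, e)⟩
    exact hd.imp (fun h => ⟨d, hdI, h⟩) fun ⟨f, h⟩ => ⟨f, d, hdI, h⟩

/-! ### The Boolean algebra of a generic theory -/

theorem Poly.value_eq_iff {f g : Poly} {w : ℕ → ZMod 2} :
    f.value w = g.value w ↔ MvPolynomial.eval w f = MvPolynomial.eval w g :=
  (ZMod.val_injective 2).eq_iff

namespace IsGeneric

variable {T : Set (Fam (ℕ → ZMod 2))} (hT : IsGeneric T)

theorem mp_of_provable (hT : IsGeneric T) {X Y : Fam (ℕ → ZMod 2)} (h : Provable (X.imp Y)) (hX : X ∈ T) : Y ∈ T :=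
  hT.mp (hT.of_provable h) hX

/-- Transfers pointwise entailment between equations to the theory; the ideal properties below are
instances. -/
theorem eq_mem {f g f' g' p q : Poly} (hT : IsGeneric T)
    (h : ∀ w, MvPolynomial.eval w f = MvPolynomial.eval w g →
      MvPolynomial.eval w f' = MvPolynomial.eval w g' →
      MvPolynomial.eval w p = MvPolynomial.eval w q)
    (h₁ : Fam.eq f.value g.value ∈ T) (h₂ : Fam.eq f'.value g'.value ∈ T) :
    Fam.eq p.value q.value ∈ T :=
  hT.mp (hT.mp (hT.of_provable (provable_eq_imp_eq_imp_eq fun w => by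
    simpa only [Poly.value_eq_iff] using h w)) h₁) h₂

/-- The ideal of the polynomials that vanish according to the theory. -/
def ideal : Ideal Poly where
  carrier := {f | Fam.eq f.value (0 : Poly).value ∈ T}
  zero_mem' := hT.of_provable (provable_eq fun _ => rfl)
  add_mem' h₁ h₂ := hT.eq_mem (fun w h h' => by simp_all) h₁ h₂
  smul_mem' g f h := hT.eq_mem (fun w h _ => by simp_all) h h

theorem mk_eq_mk_iff {f g : Poly} :
    Ideal.Quotient.mk hT.ideal f = Ideal.Quotient.mk hT.ideal g ↔ Fam.eq f.value g.value ∈ T := by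
  rw [Ideal.Quotient.eq]
  exact ⟨fun h => hT.eq_mem (fun w h _ => by simpa [sub_eq_zero] using h) h h,
    fun h => hT.eq_mem (fun w h _ => by simpa [sub_eq_zero] using h) h h⟩

/-- The Boolean ring of the values of polynomials. -/
@[reducible] noncomputable def booleanRing : BooleanRing (Poly ⧸ hT.ideal) where
  isIdempotentElem x := by
    obtain ⟨f, rfl⟩ := Ideal.Quotient.mk_surjective x
    -- A polynomial need not be idempotent, but its values are, and the quotient sees only values.
    have h : ∀ b : ZMod 2, b * b = b := by decide
    rw [IsIdempotentElem, ← map_mul, hT.mk_eq_mk_iff]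
    exact hT.of_provable (provable_eq fun w => by rw [Poly.value_eq_iff, map_mul, h])

/-- The Boolean algebra of the values of polynomials. -/
def Model : Type := AsBoolAlg (Poly ⧸ hT.ideal)

noncomputable instance : BooleanAlgebra hT.Model :=
  letI := hT.booleanRing
  inferInstanceAs (BooleanAlgebra (AsBoolAlg (Poly ⧸ hT.ideal)))

/-- The value of a polynomial. -/
noncomputable def toModel (f : Poly) : hT.Model := toBoolAlg (Ideal.Quotient.mk hT.ideal f)

theorem toModel_surjective : Function.Surjective hT.toModel :=
  toBoolAlg.surjective.comp Ideal.Quotient.mk_surjective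

theorem toModel_eq_iff {f g : Poly} : hT.toModel f = hT.toModel g ↔ Fam.eq f.value g.value ∈ T :=
  toBoolAlg_inj.trans hT.mk_eq_mk_iff

/-- The formulas in `BTerm.poly` are those by which `AsBoolAlg` defines its operations, so these
hold by `rfl`. -/
theorem toModel_mul (f g : Poly) : hT.toModel (f * g) = hT.toModel f ⊓ hT.toModel g := rfl

theorem toModel_sup (f g : Poly) : hT.toModel (f + g + f * g) = hT.toModel f ⊔ hT.toModel g := rfl

theorem toModel_compl (f : Poly) : hT.toModel (1 + f) = (hT.toModel f)ᶜ := rfl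

instance : Nontrivial hT.Model := by
  refine ⟨hT.toModel 0, hT.toModel 1, fun h => hT.consistent ?_⟩
  refine hT.mp (hT.of_provable (provable_neg_eq fun w => ?_)) (hT.toModel_eq_iff.1 h)
  rw [Ne, Poly.value_eq_iff]
  simp

theorem interp_eq {n : ℕ} (e : Fin n → Poly) (a : BTerm n) :
    a.interp (fun i => hT.toModel (e i)) = hT.toModel (a.poly e) := by
  induction a with
  | var i => rfl
  | zero => rfl
  | one => rfl
  | sup a b ha hb => rw [BTerm.interp, BTerm.poly, toModel_sup, ha, hb]
  | inf a b ha hb => rw [BTerm.interp, BTerm.poly, toModel_mul, ha, hb]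
  | compl a ha => rw [BTerm.interp, BTerm.poly, toModel_compl, ha]

theorem neg_mem_iff (hT : IsGeneric T) {n : ℕ} (A : BForm n) (e : Fin n → Poly) :
    (A.fam e).neg ∈ T ↔ A.fam e ∉ T :=
  ⟨fun h h' => hT.consistent (hT.mp h h'), (hT.decides A e).resolve_left⟩

/-- Truth in the model is membership in the generic theory. -/
theorem sat_iff {n : ℕ} (A : BForm n) (e : Fin n → Poly) :
    A.Sat (fun i => hT.toModel (e i)) ↔ A.fam e ∈ T := by
  induction A with
  | top =>
    exact iff_of_true trivial (hT.of_provable ⟨.cc, trivial, fun _ _ _ h => h.elim⟩)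
  | bot => exact iff_of_false id hT.consistent
  | ne a b =>
    rw [BForm.Sat, interp_eq, interp_eq, Ne, toModel_eq_iff, ← BForm.fam_eq, ← hT.neg_mem_iff,
      BForm.fam_eq, BForm.fam_ne]
    exact ⟨hT.mp_of_provable (provable_neg_eq_imp_ne _ _),
      hT.mp_of_provable (provable_ne_imp_neg_eq _ _)⟩
  | eq a b => rw [BForm.Sat, interp_eq, interp_eq, toModel_eq_iff, BForm.fam_eq]
  | imp A B hA hB =>
    rw [BForm.Sat, hA, hB, BForm.fam_imp]
    refine ⟨fun h => ?_, hT.mp⟩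
    rcases hT.decides A e with h' | h'
    · exact hT.mp_of_provable (provable_K _ _) (h h')
    · exact hT.mp_of_provable (provable_neg_imp_imp _ _) h'
  | or A B hA hB =>
    rw [BForm.Sat, hA, hB, BForm.fam_or]
    constructor
    · rintro (h | h)
      · exact hT.mp_of_provable (provable_or_inl _ _) h
      · exact hT.mp_of_provable (provable_or_inr _ _) h
    · intro h
      by_contra! h'
      rw [← hT.neg_mem_iff, ← hT.neg_mem_iff] at h'
      exact hT.consistent
        (hT.mp (hT.mp (hT.mp_of_provable (provable_or_elim _ _ _) h'.1) h'.2) h)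
  | and A B hA hB =>
    rw [BForm.Sat, hA, hB, BForm.fam_and]
    exact ⟨fun h => hT.mp (hT.mp_of_provable (provable_and_intro _ _) h.1) h.2, fun h =>
      ⟨hT.mp_of_provable (provable_and_left _ _) h, hT.mp_of_provable (provable_and_right _ _) h⟩⟩
  | all A hA =>
    have hcons : ∀ f : Poly, A.Sat (Fin.cons (hT.toModel f) fun i => hT.toModel (e i)) ↔
        A.fam (Fin.cons f e : _ → Poly) ∈ T := by
      intro f
      rw [← hA]
      congr! 1
      funext i
      refine Fin.cases ?_ (fun i => ?_) i <;> rfl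
    -- Every element of the model is named by a polynomial, so the Henkin witnesses suffice.
    rw [BForm.Sat, hT.toModel_surjective.forall]
    simp only [hcons]
    refine ⟨fun h => (hT.witness A e).resolve_right ?_, fun h f =>
      hT.mp_of_provable (provable_imp_of_subset (BForm.fam_cons_subset e A f)) h⟩
    rintro ⟨f, hf⟩
    exact (hT.neg_mem_iff _ _).1 hf (h f)

end IsGeneric

-- Completeness

theorem BForm.universallyRealized (A : BForm 0)
    (h : ∀ (B : Type) [BooleanAlgebra B] [Nontrivial B], A.TrueIn B) :
    UniversallyRealized A.relGimel2 := by
  have key : Provable (A.fam Fin.elim0) := by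
    by_contra hA
    obtain ⟨T, hT, hAT⟩ := Cond.exists_isGeneric
      ⟨(A.fam Fin.elim0).neg, ⟨_, (A.fam_supportedOn _).neg⟩,
        fun h' => hA ((provable_of_neg_neg _).mp h')⟩
    refine (hT.neg_mem_iff _ _).1 hAT ((hT.sat_iff _ _).1 ?_)
    rw [Subsingleton.elim (fun i => hT.toModel _) Fin.elim0]
    exact h hT.Model
  obtain ⟨t, ht, h⟩ := key
  refine ⟨t, ht, fun P => ?_⟩
  -- A closed formula contains no polynomial, so any valuation serves.
  have := h P 0
  rwa [BForm.fam, Subsingleton.elim (fun i => Poly.value _ _) Fin.elim0] at this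

/-! ### Boolean algebra axioms -/

theorem mem_theoryOf (S : Set Pole) {A : Form 0 []} (h : UniversallyRealized A) :
    A ∈ theoryOf S :=
  h.imp fun _ ht => ⟨ht.1, fun P _ => ht.2 P⟩

theorem BForm.trueIn_of_mem_booleanAxioms {A : BForm 0} (hA : A ∈ booleanAxioms) (B : Type*)
    [BooleanAlgebra B] [Nontrivial B] : A.TrueIn B := by
  simp only [booleanAxioms, Set.mem_insert_iff, Set.mem_singleton_iff] at hA
  rcases hA with rfl | rfl | rfl | rfl | rfl | rfl | rfl | rfl | rfl | rfl | rfl <;>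
    simp only [BForm.TrueIn, BForm.Sat, BTerm.interp]
  · exact fun _ _ _ => sup_comm _ _
  · exact fun _ _ _ => inf_comm _ _
  · exact fun _ _ _ => sup_assoc _ _ _
  · exact fun _ _ _ => inf_assoc _ _ _
  · exact fun _ _ _ => sup_inf_self
  · exact fun _ _ _ => inf_sup_self
  · exact fun _ _ _ => sup_inf_left _ _ _
  · exact fun _ _ _ => inf_sup_left _ _ _
  · exact fun _ _ _ => sup_compl_eq_top
  · exact fun _ _ _ => inf_compl_eq_bot
  · exact bot_ne_top

theorem id_mem_dual_gimel (P : Pole) {n : ℕ} (a : FOTerm n) (ρ : Fin n → ℕ) (σ : PVal [])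
    (h : a.value ρ < 2) : Tm.id ∈ P.dual ((Form.gimel 2 a : Form n []).falsity P ρ σ) := by
  rw [Form.gimel, Form.falsity_eq]
  refine id_mem_dual_eq P ?_
  simp [FOTerm.bin, FOTerm.succ, FOTerm.nat, FOTerm.value]
  omega

theorem universallyRealized_of_id {A : Form 0 []} (h : ∀ P : Pole, Realizes P Tm.id A) :
    UniversallyRealized A :=
  ⟨Tm.id, by simp [Tm.id, Tm.ProofLike], h⟩

/-- The relativized quantifier adds no argument to the stack, so a term common to both instances
realizes it unchanged. -/
theorem Pole.mem_dual_allGimel (P : Pole) {n : ℕ} (A : Form (n + 1) []) (ρ : Fin n → ℕ)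
    (σ : PVal []) {t : Tm 0}
    (h : ∀ m < 2, t ∈ P.dual (A.falsity P (Fin.cons m ρ : Fin (n + 1) → ℕ) σ)) :
    t ∈ P.dual ((Form.allGimel 2 A).falsity P ρ σ) := by
  intro π hπ
  obtain ⟨m, hm, hπ⟩ := Set.mem_iUnion.1 hπ
  refine h m ?_ π hπ
  simp [FOTerm.bin, FOTerm.succ, FOTerm.nat, FOTerm.value] at hm
  omega

theorem natSup_lt_two (m n : ℕ) : natSup m n < 2 := by unfold natSup; split <;> omega

theorem natInf_lt_two (m n : ℕ) : natInf m n < 2 := by unfold natInf; split <;> omega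

theorem natCompl_lt_two (m : ℕ) : natCompl m < 2 := by unfold natCompl; split <;> omega

theorem gimelTwoIsBooleanAlgebra_theoryOf (S : Set Pole) :
    GimelTwoIsBooleanAlgebra (theoryOf S) where
  zero_mem := mem_theoryOf S <| universallyRealized_of_id fun P =>
    id_mem_dual_gimel P _ _ _ Nat.zero_lt_two
  one_mem := mem_theoryOf S <| universallyRealized_of_id fun P =>
    id_mem_dual_gimel P _ _ _ Nat.one_lt_two
  sup_mem := mem_theoryOf S <| universallyRealized_of_id fun P =>
    P.mem_dual_allGimel _ _ _ fun _ _ => P.mem_dual_allGimel _ _ _ fun _ _ =>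
      id_mem_dual_gimel P _ _ _ (natSup_lt_two _ _)
  inf_mem := mem_theoryOf S <| universallyRealized_of_id fun P =>
    P.mem_dual_allGimel _ _ _ fun _ _ => P.mem_dual_allGimel _ _ _ fun _ _ =>
      id_mem_dual_gimel P _ _ _ (natInf_lt_two _ _)
  compl_mem := mem_theoryOf S <| universallyRealized_of_id fun P =>
    P.mem_dual_allGimel _ _ _ fun _ _ => id_mem_dual_gimel P _ _ _ (natCompl_lt_two _)
  axioms_mem A hA := mem_theoryOf S <| A.universallyRealized fun B _ _ =>
    BForm.trueIn_of_mem_booleanAxioms hA B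

end Realizability

theorem mainTheorem6 :
    (∀ A : Realizability.BForm 0,
      (∀ (B : Type) [BooleanAlgebra B] [Nontrivial B], A.TrueIn B) →
        Realizability.UniversallyRealized A.relGimel2) ∧
    (∀ S : Set Realizability.Pole,
      Realizability.GimelTwoIsBooleanAlgebra (Realizability.theoryOf S)) :=
  ⟨Realizability.BForm.universallyRealized, Realizability.gimelTwoIsBooleanAlgebra_theoryOf⟩
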